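/- Let $G$ be a unimodular locally compact group with (regular) Haar measure $\mu$, and let $\lambda$ be its left regular representation on $L^2(G,\mu)$, $(\lambda_x\xi)(y)=\xi(x^{-1}y)$. Let $C^*_r(G)$ be the reduced group $C^*$-algebra, i.e. the norm-closed $*$-subalgebra of $\mathcal{B}(L^2(G,\mu))$ generated by the convolution operators $\lambda(f)\xi=\int_G f(x)\,\lambda_x\xi\,d\mu(x)$, $f\in C_c(G)$. Then $C^*_r(G)$ is quasi-directly finite: writing $a\bullet b=a+b-ab$, for every $a\in C^*_r(G)$, if there is $b\in C^*_r(G)$ with $b\bullet a=0$, then there is $c\in C^*_r(G)$ with $a\bullet c=0$. Equivalently, the (forced) unitization $C^*_r(G)\oplus\mathbb{C}$ is directly finite: $uv=1$ implies $vu=1$ for all $u,v$ in it. -/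

import Mathlib

open MeasureTheory
open scoped ENNReal CompactlySupported

/-- `b` is a right quasi-inverse of `a`, and `a` is a left quasi-inverse of `b`:
`a + b - a b = 0`. -/
def IsQuasiInversePair {R : Type*} [NonUnitalRing R] (a b : R) : Prop :=
  a + b - a * b = 0

/-- A ring, possibly without identity, is quasi-directly finite if every element that has a left
quasi-inverse also has a right quasi-inverse. -/
def IsQuasiDirectlyFinite (R : Type*) [NonUnitalRing R] : Prop :=
  ∀ a : R, (∃ b : R, IsQuasiInversePair b a) → ∃ c : R, IsQuasiInversePair a c

noncomputable section

namespace GroupCStar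

variable {G : Type*} [Group G] [TopologicalSpace G] [IsTopologicalGroup G]
  [MeasurableSpace G] [BorelSpace G]

/-- The left regular representation on `L²(G, μ)`: `(λ_x ξ)(y) = ξ (x⁻¹ y)`. -/
def leftRegular (μ : Measure G) [μ.IsHaarMeasure] (x : G) : Lp ℂ 2 μ →ₗᵢ[ℂ] Lp ℂ 2 μ :=
  Lp.compMeasurePreservingₗᵢ ℂ (fun y => x⁻¹ * y) (measurePreserving_mul_left μ x⁻¹)

variable [LocallyCompactSpace G] (μ : Measure G) [μ.IsHaarMeasure] [μ.Regular]

/-- The left regular representation is strongly continuous. -/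
theorem continuous_leftRegular (ξ : Lp ℂ 2 μ) : Continuous fun x : G => leftRegular μ x ξ := by
  let g : C(G, C(G, G)) :=
    (ContinuousMap.mk (fun a : G × G => a.1⁻¹ * a.2) (by fun_prop)).curry
  exact (continuous_const (y := ξ)).compMeasurePreservingLp g.continuous
    (fun x => measurePreserving_mul_left μ x⁻¹) ENNReal.ofNat_ne_top

theorem integrable_smul_leftRegular (f : C_c(G, ℂ)) (ξ : Lp ℂ 2 μ) :
    Integrable (fun x : G => f x • leftRegular μ x ξ) μ :=
  (f.continuous.smul (continuous_leftRegular μ ξ)).integrable_of_hasCompactSupport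
    f.hasCompactSupport.smul_right

/-- The integrated form of the left regular representation: for `f ∈ C_c(G)` this is the bounded
operator `λ(f) ξ = ∫ f(x) λ_x ξ dμ(x)` on `L²(G, μ)`, that is, `ξ ↦ f * ξ`. -/
def convOperator (f : C_c(G, ℂ)) : Lp ℂ 2 μ →L[ℂ] Lp ℂ 2 μ :=
  LinearMap.mkContinuous
    { toFun := fun ξ => ∫ x, f x • leftRegular μ x ξ ∂μ
      map_add' := fun ξ η => by
        simp only [map_add, smul_add]
        exact integral_add (integrable_smul_leftRegular μ f ξ) (integrable_smul_leftRegular μ f η)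
      map_smul' := fun c ξ => by
        simp only [map_smul, RingHom.id_apply]
        rw [← integral_smul]
        simp only [smul_comm c] }
    (∫ x, ‖f x‖ ∂μ)
    (fun ξ => by
      refine (norm_integral_le_integral_norm _).trans_eq ?_
      simp only [norm_smul, LinearIsometry.norm_map]
      exact integral_mul_const _ _)

/-- The reduced group C⋆-algebra `C*_r(G)`: the norm-closed ⋆-subalgebra of the bounded operators
on `L²(G, μ)` generated by the operators `λ(f)`, `f ∈ C_c(G)`. No identity is adjoined. -/
def reducedCStar : NonUnitalStarSubalgebra ℂ (Lp ℂ 2 μ →L[ℂ] Lp ℂ 2 μ) :=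
  (NonUnitalStarAlgebra.adjoin ℂ (Set.range (convOperator μ))).topologicalClosure

end GroupCStar

end

/-!
Let `t = 1 - a` be left invertible in a unital C⋆-algebra, with `a` in a left ideal `I`. Then `t⋆t`
is invertible, so `r = (t⋆t)⁻¹t⋆` is a left inverse for which `tr` is a projection. As
`1 - r = -ra ∈ I`, the projection `1 - tr = (1 - r)a - a(1 - r)` is a commutator of elements of `I`.
If no nonzero projection is such a commutator, `t` is therefore invertible, and a perturbation
argument extends this to all `a` in the closure of `I`.

The ambient algebra is the commutant `λ(G)'`, and `I` consists of the operators acting on `C_c(G)`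
as right convolution by a vector of `L²(G, μ)`. When `S` and `T` are right convolution by `η` and
`ζ`, and `φ` runs through an approximate unit, `⟨φ, STφ⟩ → ⟨Jη, ζ⟩` with `(Jη)(x) = conj (η(x⁻¹))`,
and `⟨Jη, ζ⟩ = ⟨Jζ, η⟩`. So `⟨φ, (ST - TS)φ⟩ → 0`. If `ST - TS` is a projection, namely right
convolution by `ξ`, the same limit is `⟨ξ, ξ⟩`, whence `ξ = 0`.

Unimodularity makes `(Vξ)(x) = ξ(x⁻¹)` unitary, and conjugation by `V` embeds `C*_r(G)` in the
closure of `I`, because `Vλ(f)Vh = λ(h)Vf`.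
-/

open Filter Topology

section QuasiInverse

theorem isQuasiInversePair_iff_map_one_sub_mul {R A F : Type*} [NonUnitalRing R] [Ring A]
    [FunLike F R A] [NonUnitalRingHomClass F R A] {f : F} (hf : Function.Injective f) {a b : R} :
    IsQuasiInversePair a b ↔ (1 - f a) * (1 - f b) = 1 := by
  have hexpand : (1 - f a) * (1 - f b) = 1 - f (a + b - a * b) := by
    rw [map_sub, map_add, map_mul]
    noncomm_ring
  rw [hexpand, sub_eq_self, map_eq_zero_iff f hf, IsQuasiInversePair]

theorem IsQuasiDirectlyFinite.isQuasiInversePair_symm {R : Type*} [NonUnitalRing R]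
    (hR : IsQuasiDirectlyFinite R) {a b : R} (hba : IsQuasiInversePair b a) :
    IsQuasiInversePair a b := by
  obtain ⟨c, hac⟩ := hR a ⟨b, hba⟩
  have hinr : Function.Injective (Unitization.inrNonUnitalAlgHom ℤ R) := Unitization.inr_injective
  have hbc := left_inv_eq_right_inv ((isQuasiInversePair_iff_map_one_sub_mul hinr).1 hba)
    ((isQuasiInversePair_iff_map_one_sub_mul hinr).1 hac)
  rwa [hinr (sub_right_injective hbc)]

theorem IsQuasiDirectlyFinite.isDedekindFiniteMonoid_unitization {R : Type*} [NonUnitalRing R]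
    (hR : IsQuasiDirectlyFinite R) (𝕜 : Type*) [CommRing 𝕜] [Module 𝕜 R] [IsScalarTower 𝕜 R R]
    [SMulCommClass 𝕜 R R] : IsDedekindFiniteMonoid (Unitization 𝕜 R) := by
  refine ⟨fun {u v} huv => ?_⟩
  have hfst : u.fst * v.fst = 1 := by simpa using congrArg (fun w => w.fst) huv
  have hfst' : v.fst * u.fst = 1 := by rwa [mul_comm]
  have hsnd : u.fst • v.snd + v.fst • u.snd + u.snd * v.snd = 0 := by
    simpa using congrArg (fun w => w.snd) huv
  have hpair : IsQuasiInversePair (-(v.fst • u.snd)) (-(u.fst • v.snd)) := by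
    rw [IsQuasiInversePair, neg_mul_neg, smul_mul_smul_comm, hfst', one_smul, ← neg_eq_zero,
      ← hsnd]
    abel
  have hpair' := hR.isQuasiInversePair_symm hpair
  rw [IsQuasiInversePair, neg_mul_neg, smul_mul_smul_comm, hfst, one_smul] at hpair'
  refine Unitization.ext (by simpa using hfst') ?_
  rw [Unitization.snd_mul, Unitization.snd_one, ← neg_eq_zero, ← hpair']
  abel

end QuasiInverse

section CStarAlgebra

variable {A : Type*} [CStarAlgebra A]

theorem isUnit_star_mul_self_of_mul_eq_one {s t : A} (hst : s * t = 1) : IsUnit (star t * t) := by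
  let := CStarAlgebra.spectralOrder A
  have := CStarAlgebra.spectralOrderedRing A
  have hle : 1 ≤ ‖star s * s‖ • (star t * t) :=
    calc (1 : A) = star t * (star s * s) * t := by
          rw [mul_assoc, mul_assoc, hst, mul_one, ← star_mul, hst, star_one]
      _ ≤ ‖star s * s‖ • (star t * t) := CStarAlgebra.star_left_conjugate_le_norm_smul
  have hunit := CStarAlgebra.isUnit_of_le 1 hle
  rw [Algebra.smul_def, Commute.isUnit_mul_iff (Algebra.commutes _ _)] at hunit
  exact hunit.2

theorem exists_left_inverse_isStarProjection_mul {s t : A} (hst : s * t = 1) :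
    ∃ r : A, r * t = 1 ∧ IsStarProjection (t * r) := by
  obtain ⟨w, hw⟩ := isUnit_star_mul_self_of_mul_eq_one hst
  have hw_star : star (↑w⁻¹ : A) = ↑w⁻¹ := by
    rw [← Units.coe_star, star_inv]
    congr 2
    ext
    simp [hw]
  have hr : ↑w⁻¹ * star t * t = 1 := by rw [mul_assoc, ← hw, w.inv_mul]
  refine ⟨↑w⁻¹ * star t, hr, ?_, ?_⟩
  · rw [IsIdempotentElem, mul_assoc, ← mul_assoc _ t, hr, one_mul]
  · rw [isSelfAdjoint_iff, star_mul, star_mul, star_star, hw_star, mul_assoc]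

variable {I : Ideal A}

theorem isUnit_one_sub_of_mem_of_commutator_ne_projection
    (hI : ∀ x ∈ I, ∀ y ∈ I, IsStarProjection (x * y - y * x) → x * y - y * x = 0)
    {a u : A} (ha : a ∈ I) (hu : u * (1 - a) = 1) : IsUnit (1 - a) := by
  obtain ⟨r, hr, hproj⟩ := exists_left_inverse_isStarProjection_mul hu
  have hrI : 1 - r ∈ I := by
    have : 1 - r = -(r * a) := by rw [← hr]; noncomm_ring
    rw [this]
    exact I.neg_mem (I.mul_mem_left r ha)
  have hcomm : (1 - r) * a - a * (1 - r) = 1 - (1 - a) * r := by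
    nth_rw 3 [← hr]
    noncomm_ring
  have hzero := hI _ hrI _ ha (hcomm ▸ hproj.one_sub)
  rw [hcomm, sub_eq_zero] at hzero
  exact ⟨⟨1 - a, r, hzero.symm, hr⟩, rfl⟩

theorem one_sub_mul_eq_one_of_mem_closure
    (hI : ∀ x ∈ I, ∀ y ∈ I, IsStarProjection (x * y - y * x) → x * y - y * x = 0)
    {a u : A} (ha : a ∈ closure (I : Set A)) (hu : u * (1 - a) = 1) : (1 - a) * u = 1 := by
  obtain ⟨a', hlt, ha'⟩ : ∃ a', ‖u * (a' - a)‖ < 1 ∧ a' ∈ I := by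
    have hcont : Continuous fun x => ‖u * (x - a)‖ := by fun_prop
    exact mem_closure_iff.1 ha {x | ‖u * (x - a)‖ < 1} (isOpen_lt hcont continuous_const)
      (by simp [Set.mem_ofPred_eq])
  have hx : u * (1 - a') = 1 - u * (a' - a) := by
    nth_rw 2 [← hu]
    noncomm_ring
  obtain ⟨x, hx⟩ : IsUnit (u * (1 - a')) := hx ▸ isUnit_one_sub_of_norm_lt_one hlt
  obtain ⟨t, ht⟩ := isUnit_one_sub_of_mem_of_commutator_ne_projection hI ha'
    (u := ↑x⁻¹ * u) (by rw [mul_assoc, ← hx, x.inv_mul])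
  have hu_unit : u = ↑(x * t⁻¹) := by
    rw [Units.val_mul, Units.eq_mul_inv_iff_mul_eq, ht, hx]
  rw [hu_unit] at hu ⊢
  exact (Units.mul_eq_one_iff_inv_eq.1 hu) ▸ Units.inv_mul _

end CStarAlgebra

section CompactlySupported

variable {X : Type*} [TopologicalSpace X] [MeasurableSpace X] [BorelSpace X]

theorem norm_smul_sub_indicator_le {α E : Type*} [NormedAddCommGroup E] [NormedSpace ℝ E]
    {g : α → ℝ} {s t u : Set α} (hst : s ⊆ t) (htu : t ⊆ u) (hgs : ∀ x ∈ s, g x = 1)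
    (hgu : ∀ x ∉ u, g x = 0) (hg : ∀ x, g x ∈ Set.Icc 0 1) (c : E) (x : α) :
    ‖g x • c - t.indicator (fun _ => c) x‖ ≤ ‖(u \ s).indicator (fun _ => c) x‖ := by
  have hsub : ‖g x • c - c‖ ≤ ‖c‖ := by
    rw [← neg_sub, norm_neg, show c - g x • c = (1 - g x) • c by rw [sub_smul, one_smul],
      norm_smul, Real.norm_of_nonneg (sub_nonneg.2 (hg x).2)]
    exact mul_le_of_le_one_left (norm_nonneg c) (sub_le_self 1 (hg x).1)
  have hle : ‖g x • c‖ ≤ ‖c‖ := by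
    rw [norm_smul, Real.norm_of_nonneg (hg x).1]
    exact mul_le_of_le_one_left (norm_nonneg c) (hg x).2
  by_cases hxs : x ∈ s
  · simp [hgs x hxs, hst hxs, hxs]
  by_cases hxu : x ∈ u
  · by_cases hxt : x ∈ t <;> simpa [hxs, hxu, hxt]
  · simp [hgu x hxu, hxu, mt (@htu x) hxu]

variable {μ : Measure X}

section Approximation

variable [R1Space X] [LocallyCompactSpace X] [μ.Regular] {E : Type*} [NormedAddCommGroup E]
  [NormedSpace ℝ E] {p : ℝ≥0∞}

theorem exists_hasCompactSupport_eLpNorm_sub_indicator_le (hp : p ≠ ∞) (c : E) {t : Set X}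
    (ht : MeasurableSet t) (htμ : μ t ≠ ∞) {ε : ℝ≥0∞} (hε : ε ≠ 0) :
    ∃ g : X → E, eLpNorm (g - t.indicator fun _ => c) p μ ≤ ε ∧
      Continuous g ∧ HasCompactSupport g := by
  obtain ⟨η, hη_pos, hη⟩ := exists_eLpNorm_indicator_le (μ := μ) hp c hε
  have hη_half : (η / 2 : ℝ≥0∞) ≠ 0 := by simpa using hη_pos.ne'
  obtain ⟨V, htV, hV_open, -, hV⟩ := ht.exists_isOpen_sdiff_lt htμ hη_half
  obtain ⟨K, hKt, hK_compact, -, hK⟩ := ht.exists_isCompact_isClosed_sdiff_lt htμ hη_half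
  obtain ⟨g, hgK, hg_supp, hgV, hg⟩ :=
    exists_continuousMap_one_of_isCompact_subset_isOpen hK_compact hV_open (hKt.trans htV)
  have hVK : μ (V \ K) ≤ η :=
    calc μ (V \ K) ≤ μ (V \ t ∪ t \ K) := by
          rw [Set.sdiff_union_sdiff_cancel htV hKt]
      _ ≤ μ (V \ t) + μ (t \ K) := measure_union_le _ _
      _ ≤ η / 2 + η / 2 := add_le_add hV.le hK.le
      _ = η := ENNReal.add_halves _
  refine ⟨fun x => g x • c, (eLpNorm_mono ?_).trans (hη _ hVK), by fun_prop,
    HasCompactSupport.smul_right hg_supp⟩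
  exact norm_smul_sub_indicator_le hKt htV (fun x hx => hgK hx)
    (fun x hx => image_eq_zero_of_notMem_tsupport fun h => hx (hgV h)) hg c

-- `MemLp.exists_hasCompactSupport_eLpNorm_sub_le` assumes a normal space, which a locally compact
-- group need not be.
theorem exists_hasCompactSupport_eLpNorm_sub_le (hp : p ≠ ∞) {f : X → E} (hf : MemLp f p μ)
    {ε : ℝ≥0∞} (hε : ε ≠ 0) :
    ∃ g : X → E, eLpNorm (f - g) p μ ≤ ε ∧ Continuous g ∧ HasCompactSupport g := by
  refine hf.induction_dense hp (fun g => Continuous g ∧ HasCompactSupport g) ?_ ?_ ?_ hε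
  · exact fun c t ht htμ ε hε =>
      exists_hasCompactSupport_eLpNorm_sub_indicator_le hp c ht htμ.ne hε
  · exact fun f g hf hg => ⟨hf.1.add hg.1, hf.2.add hg.2⟩
  · exact fun g hg => (hg.1.memLp_of_hasCompactSupport (p := p) hg.2).aestronglyMeasurable

end Approximation

theorem memLp_compactlySupported [IsFiniteMeasureOnCompacts μ] (f : C_c(X, ℂ)) (p : ℝ≥0∞) :
    MemLp f p μ :=
  f.continuous.memLp_of_hasCompactSupport f.hasCompactSupport

/-- The class in `L²(X, μ)` of a compactly supported continuous function. -/
noncomputable def toL2 (μ : Measure X) [IsFiniteMeasureOnCompacts μ] (f : C_c(X, ℂ)) :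
    Lp ℂ 2 μ :=
  (memLp_compactlySupported f 2).toLp f

theorem denseRange_toL2 [R1Space X] [LocallyCompactSpace X] [μ.Regular] :
    DenseRange (toL2 μ) := by
  refine fun ξ => EMetric.mem_closure_iff.2 fun ε hε => ?_
  obtain ⟨δ, hδ, hδε⟩ := exists_between hε
  obtain ⟨g, hg, hg_cont, hg_supp⟩ :=
    exists_hasCompactSupport_eLpNorm_sub_le ENNReal.ofNat_ne_top (Lp.memLp ξ) hδ.ne'
  refine ⟨_, ⟨⟨⟨g, hg_cont⟩, hg_supp⟩, rfl⟩, lt_of_le_of_lt ?_ hδε⟩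
  rw [Lp.edist_def]
  exact (eLpNorm_congr_ae (EventuallyEq.rfl.sub (MemLp.coeFn_toLp _))).trans_le hg

theorem inner_toLp_toLp {α : Type*} [MeasurableSpace α] {ν : Measure α} {f g : α → ℂ}
    (hf : MemLp f 2 ν) (hg : MemLp g 2 ν) :
    inner ℂ (hf.toLp f) (hg.toLp g) = ∫ x, starRingEnd ℂ (f x) * g x ∂ν := by
  rw [L2.inner_def]
  refine integral_congr_ae ?_
  filter_upwards [hf.coeFn_toLp, hg.coeFn_toLp] with x hfx hgx
  rw [hfx, hgx, RCLike.inner_apply']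

theorem exists_compactlySupported_integral_eq_one [R1Space X] [LocallyCompactSpace X]
    [IsFiniteMeasureOnCompacts μ] [μ.IsOpenPosMeasure] {x : X} {U : Set X} (hU : U ∈ 𝓝 x) :
    ∃ φ : C_c(X, ℂ), Function.support φ ⊆ U ∧ ∫ y, φ y ∂μ = 1 ∧ ∫ y, ‖φ y‖ ∂μ = 1 := by
  obtain ⟨g, hg_one, hg_supp, hgU, hg⟩ := exists_continuousMap_one_of_isCompact_subset_isOpen
    (isCompact_singleton (x := x)) isOpen_interior
    (Set.singleton_subset_iff.2 (mem_interior_iff_mem_nhds.2 hU))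
  have hpos : 0 < ∫ y, g y ∂μ := g.continuous.integral_pos_of_hasCompactSupport_nonneg_nonzero
    hg_supp (fun y => (hg y).1) (ne_of_eq_of_ne (hg_one rfl) one_ne_zero)
  let ψ : C_c(X, ℂ) :=
    ⟨⟨fun y => (g y : ℂ), by fun_prop⟩,
      HasCompactSupport.comp_left (g := ((↑) : ℝ → ℂ)) hg_supp Complex.ofReal_zero⟩
  have hnorm : ∀ y, ‖ψ y‖ = g y := fun y =>
    (Complex.norm_real _).trans (Real.norm_of_nonneg (hg y).1)
  have hψ : ∫ y, ψ y ∂μ = ∫ y, g y ∂μ := integral_complex_ofReal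
  refine ⟨((∫ y, g y ∂μ : ℝ) : ℂ)⁻¹ • ψ, fun y hy => interior_subset (hgU ?_), ?_, ?_⟩
  · exact subset_tsupport _ fun h => hy (by simp [ψ, h])
  · simp only [CompactlySupportedContinuousMap.smul_apply]
    rw [integral_smul, hψ, smul_eq_mul, inv_mul_cancel₀ (Complex.ofReal_ne_zero.2 hpos.ne')]
  · simp only [CompactlySupportedContinuousMap.smul_apply, norm_smul, hnorm, norm_inv,
      Complex.norm_real, Real.norm_of_nonneg hpos.le]
    rw [integral_const_mul, inv_mul_cancel₀ hpos.ne']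

end CompactlySupported

theorem hasCompactSupport_uncurry {X Y E : Type*} [TopologicalSpace X]
    [TopologicalSpace Y] [R1Space X] [R1Space Y] [Zero E]
    {F : X → Y → E} {K : Set X} {L : Set Y} (hK : IsCompact K) (hL : IsCompact L)
    (hFK : ∀ x ∉ K, ∀ y, F x y = 0) (hFL : ∀ x, ∀ y ∉ L, F x y = 0) :
    HasCompactSupport (Function.uncurry F) := by
  refine .intro (hK.prod hL) fun ⟨x, y⟩ hxy => ?_
  rw [Set.mem_prod, not_and_or] at hxy
  exact hxy.elim (hFK x · y) (hFL x y)

theorem isInvInvariant_of_isMulRightInvariant {G : Type*} [Group G] [TopologicalSpace G]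
    [IsTopologicalGroup G] [LocallyCompactSpace G] [MeasurableSpace G] [BorelSpace G]
    (μ : Measure G) [μ.IsHaarMeasure] [μ.Regular] [μ.IsMulRightInvariant] :
    μ.IsInvInvariant := by
  have hc := Measure.isMulLeftInvariant_eq_smul_of_regular μ.inv μ
  obtain ⟨K⟩ : Nonempty (TopologicalSpace.PositiveCompacts G) := inferInstance
  have hK_pos : μ (K ∪ (K : Set G)⁻¹) ≠ 0 :=
    (Measure.measure_pos_of_nonempty_interior _ (K.interior_nonempty.mono
      (interior_mono Set.subset_union_left))).ne'
  have hK_top : μ (K ∪ (K : Set G)⁻¹) ≠ ∞ := (K.isCompact.union K.isCompact.inv).measure_ne_top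
  have hsymm : μ.inv (K ∪ (K : Set G)⁻¹) = μ (K ∪ (K : Set G)⁻¹) := by
    rw [Measure.inv_apply, Set.union_inv, inv_inv, Set.union_comm]
  have hone : μ.inv.haarScalarFactor μ = 1 := by
    rw [hc, Measure.smul_apply, ENNReal.smul_def, smul_eq_mul] at hsymm
    exact_mod_cast (ENNReal.mul_eq_right hK_pos hK_top).1 hsymm
  exact ⟨by rw [hc, hone, one_smul]⟩

noncomputable section

namespace GroupCStar

variable {G : Type*} [Group G] [TopologicalSpace G] [IsTopologicalGroup G]

section Inversion

/-- The reflection `f̌(x) = f(x⁻¹)` of `f ∈ C_c(G)`. The involution `f*(x) = conj (f(x⁻¹))` of the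
convolution algebra is `star (reflect f)`. -/
def reflect (f : C_c(G, ℂ)) : C_c(G, ℂ) :=
  f.comp (Homeomorph.inv G).toCocompactMap

theorem reflect_apply (f : C_c(G, ℂ)) (x : G) : reflect f x = f x⁻¹ := rfl

variable [MeasurableSpace G] [BorelSpace G] (μ : Measure G) [μ.IsInvInvariant]

/-- The self-adjoint unitary `(V ξ)(x) = ξ(x⁻¹)` on `L²(G, μ)`. Conjugation by it exchanges the left
and right regular representations. -/
def inversion : Lp ℂ 2 μ ≃ₗᵢ[ℂ] Lp ℂ 2 μ where
  toLinearEquiv := .ofInvolutive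
    (Lp.compMeasurePreservingₗᵢ ℂ Inv.inv (Measure.measurePreserving_inv μ)).toLinearMap
    fun ξ => by
      change Lp.compMeasurePreserving _ (Measure.measurePreserving_inv μ)
        (Lp.compMeasurePreserving _ (Measure.measurePreserving_inv μ) ξ) = ξ
      rw [← Lp.compMeasurePreserving_comp_apply]
      simp only [inv_comp_inv, Lp.compMeasurePreserving_id_apply]
  norm_map' := (Lp.compMeasurePreservingₗᵢ ℂ Inv.inv (Measure.measurePreserving_inv μ)).norm_map

theorem inversion_symm : (inversion μ).symm = inversion μ := rfl

theorem inversion_inversion (ξ : Lp ℂ 2 μ) : inversion μ (inversion μ ξ) = ξ :=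
  (inversion μ).apply_symm_apply ξ

theorem inner_inversion_left (ξ η : Lp ℂ 2 μ) :
    inner ℂ (inversion μ ξ) η = inner ℂ ξ (inversion μ η) :=
  (inversion μ).inner_map_eq_flip ξ η

theorem inversion_ae (ξ : Lp ℂ 2 μ) : inversion μ ξ =ᵐ[μ] fun x => ξ x⁻¹ :=
  Lp.coeFn_compMeasurePreserving ξ (Measure.measurePreserving_inv μ)

theorem inversion_toL2 [IsFiniteMeasureOnCompacts μ] (f : C_c(G, ℂ)) :
    inversion μ (toL2 μ f) = toL2 μ (reflect f) := rfl

/-- The conjugate-linear isometry `(J ξ)(x) = conj (ξ(x⁻¹))` on `L²(G, μ)`, as a real-linear map;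
it extends the involution of `C_c(G)`. -/
def modularConj : Lp ℂ 2 μ →L[ℝ] Lp ℂ 2 μ :=
  (Complex.conjCLE.toContinuousLinearMap.compLpL 2 μ) ∘L
    (inversion μ).toContinuousLinearEquiv.toContinuousLinearMap.restrictScalars ℝ

theorem modularConj_ae (ξ : Lp ℂ 2 μ) : modularConj μ ξ =ᵐ[μ] fun x => starRingEnd ℂ (ξ x⁻¹) := by
  refine (ContinuousLinearMap.coeFn_compLpL _ _).trans ?_
  filter_upwards [inversion_ae μ ξ] with x hx
  exact congrArg (starRingEnd ℂ) hx

theorem modularConj_toL2 [IsFiniteMeasureOnCompacts μ] (f : C_c(G, ℂ)) :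
    modularConj μ (toL2 μ f) = toL2 μ (star (reflect f)) := by
  refine Lp.ext <| (ContinuousLinearMap.coeFn_compLpL _ _).trans ?_
  filter_upwards [(memLp_compactlySupported (reflect f) 2).coeFn_toLp (μ := μ),
    (memLp_compactlySupported (star (reflect f)) 2).coeFn_toLp (μ := μ)] with x hx hx'
  exact (congrArg (starRingEnd ℂ) hx).trans hx'.symm

theorem modularConj_modularConj (ξ : Lp ℂ 2 μ) : modularConj μ (modularConj μ ξ) = ξ := by
  refine Lp.ext ?_
  filter_upwards [modularConj_ae μ (modularConj μ ξ),
    (Measure.measurePreserving_inv μ).quasiMeasurePreserving.ae_eq_comp (modularConj_ae μ ξ)]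
    with x hx hx'
  exact hx.trans ((congrArg (starRingEnd ℂ) hx').trans (by simp))

theorem inner_modularConj_modularConj (ξ η : Lp ℂ 2 μ) :
    inner ℂ (modularConj μ ξ) (modularConj μ η) = inner ℂ η ξ := by
  rw [L2.inner_def, L2.inner_def, ← integral_inv_eq_self (fun x => inner ℂ (η x) (ξ x)) μ]
  refine integral_congr_ae ?_
  filter_upwards [modularConj_ae μ ξ, modularConj_ae μ η] with x hξ hη
  rw [hξ, hη, RCLike.inner_apply, RCLike.inner_apply, RCLike.conj_conj, mul_comm]

theorem inner_modularConj_comm (ξ η : Lp ℂ 2 μ) :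
    inner ℂ (modularConj μ ξ) η = inner ℂ (modularConj μ η) ξ := by
  rw [← inner_modularConj_modularConj, modularConj_modularConj]

end Inversion

section LeftRegular

variable [MeasurableSpace G] [BorelSpace G] {μ : Measure G} [μ.IsHaarMeasure]

theorem leftRegular_one (ξ : Lp ℂ 2 μ) : leftRegular μ 1 ξ = ξ := by
  refine Lp.ext ?_
  filter_upwards [Lp.coeFn_compMeasurePreserving ξ (measurePreserving_mul_left μ (1 : G)⁻¹)]
    with x hx
  exact hx.trans (by simp)

theorem leftRegular_leftRegular (x y : G) (ξ : Lp ℂ 2 μ) :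
    leftRegular μ x (leftRegular μ y ξ) = leftRegular μ (x * y) ξ := by
  change Lp.compMeasurePreserving _ (measurePreserving_mul_left μ x⁻¹)
    (Lp.compMeasurePreserving _ (measurePreserving_mul_left μ y⁻¹) ξ) =
      Lp.compMeasurePreserving _ (measurePreserving_mul_left μ (x * y)⁻¹) ξ
  rw [← Lp.compMeasurePreserving_comp_apply]
  congr 1
  simp only [Function.comp_def, mul_inv_rev, mul_assoc]

theorem inner_leftRegular_left (x : G) (ξ η : Lp ℂ 2 μ) :
    inner ℂ (leftRegular μ x ξ) η = inner ℂ ξ (leftRegular μ x⁻¹ η) := by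
  rw [← (leftRegular μ x⁻¹).inner_map_map, leftRegular_leftRegular, inv_mul_cancel,
    leftRegular_one]

theorem star_leftRegular (x : G) :
    star (leftRegular μ x).toContinuousLinearMap =
      (leftRegular μ x⁻¹).toContinuousLinearMap := by
  rw [ContinuousLinearMap.star_eq_adjoint, eq_comm, ContinuousLinearMap.eq_adjoint_iff]
  exact fun ξ η => (inner_leftRegular_left x⁻¹ ξ η).trans (by rw [inv_inv]; rfl)

theorem inner_toL2_leftRegular_toL2 (k h : C_c(G, ℂ)) (x : G) :
    inner ℂ (toL2 μ k) (leftRegular μ x (toL2 μ h)) =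
      ∫ z, starRingEnd ℂ (k z) * h (x⁻¹ * z) ∂μ :=
  inner_toLp_toLp (memLp_compactlySupported k 2)
    ((memLp_compactlySupported h 2).comp_measurePreserving (measurePreserving_mul_left μ x⁻¹))

theorem leftRegular_inversion_leftRegular_inversion [μ.IsInvInvariant] (x y : G) (ξ : Lp ℂ 2 μ) :
    leftRegular μ x (inversion μ (leftRegular μ y (inversion μ ξ))) =
      inversion μ (leftRegular μ y (inversion μ (leftRegular μ x ξ))) := by
  change Lp.compMeasurePreserving _ (measurePreserving_mul_left μ x⁻¹)
    (Lp.compMeasurePreserving _ (Measure.measurePreserving_inv μ)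
      (Lp.compMeasurePreserving _ (measurePreserving_mul_left μ y⁻¹)
        (Lp.compMeasurePreserving _ (Measure.measurePreserving_inv μ) ξ))) =
    Lp.compMeasurePreserving _ (Measure.measurePreserving_inv μ)
      (Lp.compMeasurePreserving _ (measurePreserving_mul_left μ y⁻¹)
        (Lp.compMeasurePreserving _ (Measure.measurePreserving_inv μ)
          (Lp.compMeasurePreserving _ (measurePreserving_mul_left μ x⁻¹) ξ)))
  simp only [← Lp.compMeasurePreserving_comp_apply]
  congr 2
  funext z
  simp [mul_assoc]

end LeftRegular

section ConvOperator

variable [LocallyCompactSpace G] [MeasurableSpace G] [BorelSpace G]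
  {μ : Measure G} [μ.IsHaarMeasure] [μ.Regular]

theorem convOperator_apply (f : C_c(G, ℂ)) (ξ : Lp ℂ 2 μ) :
    convOperator μ f ξ = ∫ x, f x • leftRegular μ x ξ ∂μ := rfl

theorem inner_convOperator_right (f : C_c(G, ℂ)) (ξ η : Lp ℂ 2 μ) :
    inner ℂ ξ (convOperator μ f η) = ∫ x, f x * inner ℂ ξ (leftRegular μ x η) ∂μ := by
  rw [convOperator_apply, ← integral_inner (integrable_smul_leftRegular μ f η)]
  simp only [inner_smul_right]

theorem inner_toL2_convOperator_toL2 (k f h : C_c(G, ℂ)) :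
    inner ℂ (toL2 μ k) (convOperator μ f (toL2 μ h)) =
      ∫ z, starRingEnd ℂ (k z) * ∫ x, f x * h (x⁻¹ * z) ∂μ ∂μ := by
  simp only [inner_convOperator_right, inner_toL2_leftRegular_toL2, ← integral_const_mul]
  rw [integral_integral_swap_of_hasCompactSupport]
  · simp only [mul_left_comm]
  · simp only [Function.uncurry_def]
    fun_prop
  · refine hasCompactSupport_uncurry f.hasCompactSupport k.hasCompactSupport
      (fun x hx z => ?_) (fun x z hz => ?_)
    · rw [image_eq_zero_of_notMem_tsupport hx, zero_mul]
    · rw [image_eq_zero_of_notMem_tsupport hz, map_zero, zero_mul, mul_zero]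

theorem star_convOperator [μ.IsInvInvariant] (f : C_c(G, ℂ)) :
    star (convOperator μ f) = convOperator μ (star (reflect f)) := by
  rw [ContinuousLinearMap.star_eq_adjoint, eq_comm, ContinuousLinearMap.eq_adjoint_iff]
  intro ξ η
  rw [← inner_conj_symm, inner_convOperator_right, inner_convOperator_right, ← integral_conj,
    ← integral_inv_eq_self _ μ]
  refine integral_congr_ae (.of_forall fun x => ?_)
  simp only [map_mul, inner_conj_symm, inner_leftRegular_left, inv_inv]
  simp [reflect_apply]

-- Both sides are right convolution of `f` by `h`: the first because `V` exchanges left and right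
-- convolution, the second by definition.
theorem inversion_convOperator_inversion_toL2 [μ.IsInvInvariant] (f h : C_c(G, ℂ)) :
    inversion μ (convOperator μ f (inversion μ (toL2 μ h))) =
      convOperator μ h (inversion μ (toL2 μ f)) := by
  refine denseRange_toL2.eq_of_inner_right ℂ fun k => ?_
  rw [← inner_inversion_left, inversion_toL2, inversion_toL2, inversion_toL2,
    inner_toL2_convOperator_toL2, inner_toL2_convOperator_toL2, ← integral_inv_eq_self _ μ]
  refine integral_congr_ae (.of_forall fun z => ?_)
  simp only [reflect_apply, inv_inv, mul_inv_rev]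
  rw [← integral_mul_left_eq_self _ z⁻¹]
  simp only [mul_inv_cancel_left, mul_comm]

theorem inner_convOperator_toL2 [μ.IsInvInvariant] (k h : C_c(G, ℂ)) (ζ : Lp ℂ 2 μ) :
    inner ℂ (convOperator μ k ζ) (toL2 μ h) =
      inner ℂ (toL2 μ k) (convOperator μ h (modularConj μ ζ)) := by
  have hJ := (modularConj μ).continuous
  refine denseRange_toL2.induction_on ζ (isClosed_eq (by fun_prop) (by fun_prop)) fun f => ?_
  have hstar : star (convOperator μ (star f)) = convOperator μ (reflect f) := by
    rw [star_convOperator]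
    congr 1
    ext x
    simp [reflect_apply]
  calc inner ℂ (convOperator μ k (toL2 μ f)) (toL2 μ h)
      = inner ℂ (convOperator μ k (inversion μ (toL2 μ (reflect f)))) (toL2 μ h) := by
        rw [← inversion_toL2, inversion_inversion]
    _ = inner ℂ (inversion μ (star (convOperator μ (star f)) (inversion μ (toL2 μ k))))
          (toL2 μ h) := by rw [← inversion_convOperator_inversion_toL2, hstar]
    _ = inner ℂ (toL2 μ k)
          (inversion μ (convOperator μ (star f) (inversion μ (toL2 μ h)))) := by
        rw [inner_inversion_left, ContinuousLinearMap.star_eq_adjoint,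
          ContinuousLinearMap.adjoint_inner_left, inner_inversion_left]
    _ = inner ℂ (toL2 μ k) (convOperator μ h (modularConj μ (toL2 μ f))) := by
        rw [inversion_convOperator_inversion_toL2, inversion_toL2, modularConj_toL2]
        rfl

end ConvOperator

section ApproximateUnit

variable [LocallyCompactSpace G] [MeasurableSpace G] [BorelSpace G]
  {μ : Measure G} [μ.IsHaarMeasure] [μ.Regular]

/-- The filter on `C_c(G)` of approximate units: functions with integral and `L¹` norm one whose
supports shrink to the identity. -/
def approxUnit {G : Type*} [One G] [TopologicalSpace G] [MeasurableSpace G] (μ : Measure G) :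
    Filter C_c(G, ℂ) :=
  comap (fun φ => Function.support φ) (𝓝 1).smallSets ⊓
    𝓟 {φ | ∫ x, φ x ∂μ = 1 ∧ ∫ x, ‖φ x‖ ∂μ = 1}

instance approxUnit_neBot : (approxUnit μ).NeBot := by
  refine ((𝓝 (1 : G)).basis_sets.smallSets.comap _).inf_principal_neBot_iff.2 fun {U} hU => ?_
  obtain ⟨φ, hφ⟩ := exists_compactlySupported_integral_eq_one (μ := μ) hU
  exact ⟨φ, hφ⟩

theorem norm_convOperator_sub_le {φ : C_c(G, ℂ)} (hφ : ∫ x, φ x ∂μ = 1)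
    (hφ_norm : ∫ x, ‖φ x‖ ∂μ = 1) {ξ : Lp ℂ 2 μ} {ε : ℝ}
    (hξ : ∀ x ∈ Function.support φ, ‖leftRegular μ x ξ - ξ‖ ≤ ε) :
    ‖convOperator μ φ ξ - ξ‖ ≤ ε := by
  have hint : Integrable φ μ := φ.continuous.integrable_of_hasCompactSupport φ.hasCompactSupport
  have hsub : convOperator μ φ ξ - ξ = ∫ x, φ x • (leftRegular μ x ξ - ξ) ∂μ := by
    simp only [smul_sub]
    rw [integral_sub (integrable_smul_leftRegular μ φ ξ) (hint.smul_const ξ),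
      integral_smul_const, hφ, one_smul, convOperator_apply]
  calc ‖convOperator μ φ ξ - ξ‖ ≤ ∫ x, ‖φ x‖ * ε ∂μ := by
        rw [hsub]
        refine norm_integral_le_of_norm_le (hint.norm.mul_const ε) (.of_forall fun x => ?_)
        rw [norm_smul]
        by_cases hx : φ x = 0
        · simp [hx]
        · exact mul_le_mul_of_nonneg_left (hξ x hx) (norm_nonneg _)
    _ = ε := by rw [integral_mul_const, hφ_norm, one_mul]

theorem tendsto_convOperator_approxUnit (ξ : Lp ℂ 2 μ) :
    Tendsto (fun φ => convOperator μ φ ξ) (approxUnit μ) (𝓝 ξ) := by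
  refine Metric.nhds_basis_closedBall.tendsto_right_iff.2 fun ε hε => ?_
  have hnhds : ∀ᶠ x in 𝓝 (1 : G), ‖leftRegular μ x ξ - ξ‖ ≤ ε := by
    have hcont : Continuous fun x => ‖leftRegular μ x ξ - ξ‖ :=
      ((continuous_leftRegular μ ξ).sub continuous_const).norm
    exact hcont.continuousAt.eventually (Iic_mem_nhds (by simpa [leftRegular_one] using hε))
  filter_upwards [mem_inf_of_left (preimage_mem_comap hnhds.smallSets),
    mem_inf_of_right (mem_principal_self _)] with φ hφ_supp hφ
  rw [mem_closedBall_iff_norm]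
  exact norm_convOperator_sub_le hφ.1 hφ.2 hφ_supp

end ApproximateUnit

section LeftCommutant

variable [MeasurableSpace G] [BorelSpace G] {μ : Measure G} [μ.IsHaarMeasure]

/-- The commutant `λ(G)'` of the left regular representation, i.e. the right group von Neumann
algebra. -/
def leftCommutant (μ : Measure G) [μ.IsHaarMeasure] :
    StarSubalgebra ℂ (Lp ℂ 2 μ →L[ℂ] Lp ℂ 2 μ) :=
  StarSubalgebra.centralizer ℂ (Set.range fun x => (leftRegular μ x).toContinuousLinearMap)

theorem mem_leftCommutant {T : Lp ℂ 2 μ →L[ℂ] Lp ℂ 2 μ} :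
    T ∈ leftCommutant μ ↔ ∀ x ξ, leftRegular μ x (T ξ) = T (leftRegular μ x ξ) := by
  rw [leftCommutant, StarSubalgebra.mem_centralizer_iff]
  refine ⟨fun hT x ξ => DFunLike.congr_fun (hT _ ⟨x, rfl⟩).1 ξ, ?_⟩
  rintro hT _ ⟨x, rfl⟩
  rw [star_leftRegular]
  exact ⟨ContinuousLinearMap.ext (hT x), ContinuousLinearMap.ext (hT x⁻¹)⟩

instance isClosed_leftCommutant :
    IsClosed (leftCommutant μ : Set (Lp ℂ 2 μ →L[ℂ] Lp ℂ 2 μ)) :=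
  Set.isClosed_centralizer _

theorem conj_leftRegular_mem_leftCommutant [μ.IsInvInvariant] (x : G) :
    (inversion μ).conjStarAlgEquiv (leftRegular μ x).toContinuousLinearMap ∈ leftCommutant μ :=
  mem_leftCommutant.2 fun y ξ => leftRegular_inversion_leftRegular_inversion y x ξ

variable [LocallyCompactSpace G] [μ.Regular]

theorem apply_convOperator_of_mem_leftCommutant {T : Lp ℂ 2 μ →L[ℂ] Lp ℂ 2 μ}
    (hT : T ∈ leftCommutant μ) (f : C_c(G, ℂ)) (ξ : Lp ℂ 2 μ) :
    T (convOperator μ f ξ) = convOperator μ f (T ξ) := by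
  rw [convOperator_apply, convOperator_apply,
    ← T.integral_comp_comm (integrable_smul_leftRegular μ f ξ)]
  simp only [map_smul, mem_leftCommutant.1 hT]

theorem conj_convOperator_mem_leftCommutant [μ.IsInvInvariant] (f : C_c(G, ℂ)) :
    (inversion μ).conjStarAlgEquiv (convOperator μ f) ∈ leftCommutant μ := by
  refine mem_leftCommutant.2 fun x ξ => ?_
  have hcomm := apply_convOperator_of_mem_leftCommutant
    (conj_leftRegular_mem_leftCommutant x) f (inversion μ ξ)
  simp only [LinearIsometryEquiv.conjStarAlgEquiv_apply_apply, inversion_symm,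
    inversion_inversion, LinearIsometry.coe_toContinuousLinearMap] at hcomm ⊢
  rw [← hcomm, inversion_inversion]

end LeftCommutant

section RightConvolution

variable [LocallyCompactSpace G] [MeasurableSpace G] [BorelSpace G]
  {μ : Measure G} [μ.IsHaarMeasure] [μ.Regular]

/-- `T` acts on `C_c(G)` as right convolution `h ↦ h * ζ` by a vector `ζ ∈ L²(G, μ)`. -/
def IsRightConvolution (T : Lp ℂ 2 μ →L[ℂ] Lp ℂ 2 μ) (ζ : Lp ℂ 2 μ) : Prop :=
  ∀ h : C_c(G, ℂ), T (toL2 μ h) = convOperator μ h ζ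

namespace IsRightConvolution

variable {S T : Lp ℂ 2 μ →L[ℂ] Lp ℂ 2 μ} {η ζ : Lp ℂ 2 μ}

theorem zero : IsRightConvolution (0 : Lp ℂ 2 μ →L[ℂ] Lp ℂ 2 μ) 0 :=
  fun h => (map_zero (convOperator μ h)).symm

theorem add (hS : IsRightConvolution S η) (hT : IsRightConvolution T ζ) :
    IsRightConvolution (S + T) (η + ζ) :=
  fun h => by rw [add_apply, hS, hT, map_add]

theorem smul (c : ℂ) (hT : IsRightConvolution T ζ) : IsRightConvolution (c • T) (c • ζ) :=
  fun h => by rw [smul_apply, hT, map_smul]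

theorem mul_left (hS : S ∈ leftCommutant μ) (hT : IsRightConvolution T ζ) :
    IsRightConvolution (S * T) (S ζ) :=
  fun h => by rw [mul_apply_eq_comp, hT, apply_convOperator_of_mem_leftCommutant hS]

theorem tendsto_approxUnit (hT : IsRightConvolution T ζ) :
    Tendsto (fun φ => T (toL2 μ φ)) (approxUnit μ) (𝓝 ζ) :=
  (tendsto_convOperator_approxUnit ζ).congr fun φ => (hT φ).symm

theorem eq_zero (hT : IsRightConvolution T 0) : T = 0 :=
  ContinuousLinearMap.ext fun ξ => denseRange_toL2.induction_on ξ
    (isClosed_eq T.continuous continuous_const) fun h => (hT h).trans (map_zero _)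

variable [μ.IsInvInvariant]

theorem star (hT : IsRightConvolution T ζ) : IsRightConvolution (star T) (modularConj μ ζ) := by
  refine fun h => denseRange_toL2.eq_of_inner_right ℂ fun k => ?_
  rw [ContinuousLinearMap.star_eq_adjoint, ContinuousLinearMap.adjoint_inner_right, hT,
    inner_convOperator_toL2]

theorem tendsto_inner_mul (hS : IsRightConvolution S η) (hT : IsRightConvolution T ζ) :
    Tendsto (fun φ => inner ℂ (toL2 μ φ) ((S * T) (toL2 μ φ))) (approxUnit μ)
      (𝓝 (inner ℂ (modularConj μ η) ζ)) := by
  refine (hS.star.tendsto_approxUnit.inner hT.tendsto_approxUnit).congr fun φ => ?_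
  rw [ContinuousLinearMap.star_eq_adjoint, ContinuousLinearMap.adjoint_inner_left]
  rfl

theorem tendsto_inner_commutator (hS : IsRightConvolution S η) (hT : IsRightConvolution T ζ) :
    Tendsto (fun φ => inner ℂ (toL2 μ φ) ((S * T - T * S) (toL2 μ φ))) (approxUnit μ)
      (𝓝 0) := by
  have hlim := (hS.tendsto_inner_mul hT).sub (hT.tendsto_inner_mul hS)
  rw [inner_modularConj_comm, sub_self] at hlim
  simpa only [sub_apply, inner_sub_right] using hlim

theorem commutator_eq_zero (hS : IsRightConvolution S η) (hT : IsRightConvolution T ζ)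
    {ξ : Lp ℂ 2 μ} (hcomm : IsRightConvolution (S * T - T * S) ξ)
    (hproj : IsStarProjection (S * T - T * S)) : S * T - T * S = 0 := by
  have hlim := hS.tendsto_inner_commutator hT
  set P := S * T - T * S
  have hinner : ∀ φ, inner ℂ (toL2 μ φ) (P (toL2 μ φ)) =
      inner ℂ (P (toL2 μ φ)) (P (toL2 μ φ)) := fun φ => by
    rw [← ContinuousLinearMap.adjoint_inner_right, ← ContinuousLinearMap.star_eq_adjoint,
      hproj.isSelfAdjoint.star_eq]
    exact congrArg (fun Q : Lp ℂ 2 μ →L[ℂ] Lp ℂ 2 μ => inner ℂ (toL2 μ φ) (Q (toL2 μ φ)))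
      hproj.isIdempotentElem.symm
  simp only [hinner] at hlim
  have hξ : inner ℂ ξ ξ = 0 :=
    tendsto_nhds_unique (hcomm.tendsto_approxUnit.inner hcomm.tendsto_approxUnit) hlim
  rw [inner_self_eq_zero] at hξ
  exact (hξ ▸ hcomm).eq_zero

end IsRightConvolution

/-- The left ideal of `λ(G)'` formed by the right convolutions by vectors of `L²(G, μ)`. -/
def rightConvIdeal (μ : Measure G) [μ.IsHaarMeasure] [μ.Regular] : Ideal (leftCommutant μ) where
  carrier := {T | ∃ ζ, IsRightConvolution (T : Lp ℂ 2 μ →L[ℂ] Lp ℂ 2 μ) ζ}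
  zero_mem' := ⟨0, .zero⟩
  add_mem' := fun ⟨_, hη⟩ ⟨_, hζ⟩ => ⟨_, hη.add hζ⟩
  smul_mem' := fun S _ ⟨_, hζ⟩ => ⟨_, hζ.mul_left S.2⟩

theorem mem_rightConvIdeal {T : leftCommutant μ} :
    T ∈ rightConvIdeal μ ↔ ∃ ζ, IsRightConvolution (T : Lp ℂ 2 μ →L[ℂ] Lp ℂ 2 μ) ζ := Iff.rfl

variable [μ.IsInvInvariant]

theorem isRightConvolution_conj_convOperator (f : C_c(G, ℂ)) :
    IsRightConvolution ((inversion μ).conjStarAlgEquiv (convOperator μ f))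
      (inversion μ (toL2 μ f)) :=
  inversion_convOperator_inversion_toL2 f

/-- The operators in `λ(G)'` that are right convolution by a vector of `L²(G, μ)`. -/
def rightConvAlgebra (μ : Measure G) [μ.IsHaarMeasure] [μ.Regular] [μ.IsInvInvariant] :
    NonUnitalStarSubalgebra ℂ (Lp ℂ 2 μ →L[ℂ] Lp ℂ 2 μ) where
  carrier := {T | T ∈ leftCommutant μ ∧ ∃ ζ, IsRightConvolution T ζ}
  zero_mem' := ⟨zero_mem _, 0, .zero⟩
  add_mem' := fun ⟨hS, _, hη⟩ ⟨hT, _, hζ⟩ => ⟨add_mem hS hT, _, hη.add hζ⟩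
  smul_mem' := fun c _ ⟨hT, _, hζ⟩ => ⟨SMulMemClass.smul_mem c hT, _, hζ.smul c⟩
  mul_mem' := fun ⟨hS, _⟩ ⟨hT, _, hζ⟩ => ⟨mul_mem hS hT, _, hζ.mul_left hS⟩
  star_mem' := fun ⟨hT, _, hζ⟩ => ⟨star_mem hT, _, hζ.star⟩

theorem commutator_eq_zero_of_mem_rightConvIdeal {S T : leftCommutant μ}
    (hS : S ∈ rightConvIdeal μ) (hT : T ∈ rightConvIdeal μ)
    (hproj : IsStarProjection (S * T - T * S)) : S * T - T * S = 0 := by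
  have hcomm : S * T - T * S ∈ rightConvIdeal μ :=
    sub_mem (Ideal.mul_mem_left _ S hT) (Ideal.mul_mem_left _ T hS)
  obtain ⟨η, hη⟩ := mem_rightConvIdeal.1 hS
  obtain ⟨ζ, hζ⟩ := mem_rightConvIdeal.1 hT
  obtain ⟨ξ, hξ⟩ := mem_rightConvIdeal.1 hcomm
  exact Subtype.ext (hη.commutator_eq_zero hζ hξ (hproj.map (leftCommutant μ).subtype))

end RightConvolution

section ReducedCStar

variable [LocallyCompactSpace G] [MeasurableSpace G] [BorelSpace G]
  {μ : Measure G} [μ.IsHaarMeasure] [μ.Regular] [μ.IsInvInvariant]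

theorem conj_mem_closure_rightConvAlgebra {a : Lp ℂ 2 μ →L[ℂ] Lp ℂ 2 μ}
    (ha : a ∈ reducedCStar μ) :
    (inversion μ).conjStarAlgEquiv a ∈
      closure (rightConvAlgebra μ : Set (Lp ℂ 2 μ →L[ℂ] Lp ℂ 2 μ)) := by
  have hle : NonUnitalStarAlgebra.adjoin ℂ (Set.range (convOperator μ)) ≤
      (rightConvAlgebra μ).comap (inversion μ).conjStarAlgEquiv := by
    refine NonUnitalStarAlgebra.adjoin_le ?_
    rintro _ ⟨f, rfl⟩
    exact ⟨conj_convOperator_mem_leftCommutant f, _, isRightConvolution_conj_convOperator f⟩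
  have hcont : Continuous (inversion μ).conjStarAlgEquiv := by
    change Continuous fun a => ((inversion μ).conjStarAlgEquiv a)
    simp only [LinearIsometryEquiv.conjStarAlgEquiv_apply]
    fun_prop
  exact map_mem_closure hcont ha hle

theorem mem_closure_rightConvIdeal {T : leftCommutant μ}
    (hT : (T : Lp ℂ 2 μ →L[ℂ] Lp ℂ 2 μ) ∈
      closure (rightConvAlgebra μ : Set (Lp ℂ 2 μ →L[ℂ] Lp ℂ 2 μ))) :
    T ∈ closure (rightConvIdeal μ : Set (leftCommutant μ)) := by
  have hsub : (rightConvAlgebra μ : Set (Lp ℂ 2 μ →L[ℂ] Lp ℂ 2 μ)) ⊆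
      Subtype.val '' (rightConvIdeal μ : Set (leftCommutant μ)) :=
    fun S hS => ⟨⟨S, hS.1⟩, hS.2, rfl⟩
  exact closure_subtype.2 (closure_mono hsub hT)

theorem isQuasiDirectlyFinite_reducedCStar : IsQuasiDirectlyFinite (reducedCStar μ) := by
  rintro a ⟨b, hba⟩
  let Φ : reducedCStar μ →⋆ₙₐ[ℂ] (Lp ℂ 2 μ →L[ℂ] Lp ℂ 2 μ) :=
    ((inversion μ).conjStarAlgEquiv : _ →⋆ₙₐ[ℂ] _).comp
      (NonUnitalStarSubalgebraClass.subtype (reducedCStar μ))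
  have hΦ : Function.Injective Φ :=
    (inversion μ).conjStarAlgEquiv.injective.comp Subtype.val_injective
  have hΦ_closure : ∀ c, Φ c ∈ closure (rightConvAlgebra μ : Set (Lp ℂ 2 μ →L[ℂ] Lp ℂ 2 μ)) :=
    fun c => conj_mem_closure_rightConvAlgebra c.2
  have hΦ_mem : ∀ c, Φ c ∈ leftCommutant μ :=
    fun c => closure_minimal (fun T hT => hT.1) isClosed_leftCommutant (hΦ_closure c)
  have ha : (⟨Φ a, hΦ_mem a⟩ : leftCommutant μ) ∈
      closure (rightConvIdeal μ : Set (leftCommutant μ)) :=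
    mem_closure_rightConvIdeal (hΦ_closure a)
  have hba' : (1 - ⟨Φ b, hΦ_mem b⟩ : leftCommutant μ) * (1 - ⟨Φ a, hΦ_mem a⟩) = 1 :=
    Subtype.ext ((isQuasiInversePair_iff_map_one_sub_mul hΦ).1 hba)
  have hab := one_sub_mul_eq_one_of_mem_closure (A := leftCommutant μ)
    (fun _ hS _ hT => commutator_eq_zero_of_mem_rightConvIdeal hS hT) ha hba'
  exact ⟨b, (isQuasiInversePair_iff_map_one_sub_mul hΦ).2 (congrArg Subtype.val hab)⟩

end ReducedCStar

end GroupCStar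

end

theorem theorem3 {G : Type*} [Group G] [TopologicalSpace G] [IsTopologicalGroup G]
    [LocallyCompactSpace G] [MeasurableSpace G] [BorelSpace G]
    (μ : Measure G) [μ.IsHaarMeasure] [μ.Regular]
    (unimodular : μ.IsMulRightInvariant) :
    IsQuasiDirectlyFinite (GroupCStar.reducedCStar μ) ∧
      IsDedekindFiniteMonoid (Unitization ℂ (GroupCStar.reducedCStar μ)) := by
  have := isInvInvariant_of_isMulRightInvariant μ
  have hfinite := GroupCStar.isQuasiDirectlyFinite_reducedCStar (μ := μ)
  exact ⟨hfinite, hfinite.isDedekindFiniteMonoid_unitization ℂ⟩
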